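/- For $p<0$ and a nonempty compact set $K\subset\mathbb R^2$, let $$V_p(K)=\max_\mu\int_K\int_K |x-y|^{-p}\,d\mu(x)\,d\mu(y),$$ where the maximum is over all Borel probability measures $\mu$ on $K$, and let $\mathrm{Cap}_p(K)=V_p(K)^{-1/p}$ be the Riesz $p$-capacity of $K$; it is positive whenever $K$ has more than one point. Consider compact sets $K\subset\mathbb R^2$ containing more than one point. (a) If $p<q\le -2$, then among all such $K$ the ratio $\mathrm{Cap}_q(K)/\mathrm{Cap}_p(K)$ has the maximal value $(2/3)^{1/p-1/q}$, and this value is attained whenever $K$ is the set of vertices of an equilateral triangle. (b) If $q<p<0$ and $q\le -2$, then among all such $K$ the ratio $\mathrm{Cap}_q(K)/\mathrm{Cap}_p(K)$ has the maximal value $2^{1/q-1/p}$, and this value is attained whenever $K$ consists of exactly two points. -/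

import Mathlib

open MeasureTheory

/-- The Riesz double integral `∬ |x - y|^{-p} dμ(x) dμ(y)` of a measure `μ` on `ℝⁿ`. -/
noncomputable def rieszDoubleIntegral {n : ℕ} (p : ℝ)
    (μ : Measure (EuclideanSpace ℝ (Fin n))) : ℝ :=
  ∫ x, ∫ y, dist x y ^ (-p) ∂μ ∂μ

/-- The values of the Riesz double integral over all Borel probability measures on `K`. -/
def rieszEnergyValues {n : ℕ} (p : ℝ) (K : Set (EuclideanSpace ℝ (Fin n))) : Set ℝ :=
  {E | ∃ μ : Measure (EuclideanSpace ℝ (Fin n)),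
    IsProbabilityMeasure μ ∧ μ Kᶜ = 0 ∧ E = rieszDoubleIntegral p μ}

/-- The Riesz `p`-energy of a compact set `K ⊆ ℝⁿ` for a negative exponent `p < 0`
(the only exponents for which this definition is meant): the largest value of the double integral
over the Borel probability measures on `K`, and `0` for the empty set. -/
noncomputable def rieszEnergy {n : ℕ} (p : ℝ) (K : Set (EuclideanSpace ℝ (Fin n))) : ℝ :=
  sSup (rieszEnergyValues p K)

/-- The Riesz `p`-capacity `V_p(K)^{-1/p}` of a compact set `K ⊆ ℝⁿ`, for `p < 0`. -/
noncomputable def rieszCapacity {n : ℕ} (p : ℝ) (K : Set (EuclideanSpace ℝ (Fin n))) : ℝ :=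
  rieszEnergy p K ^ (-1 / p)

/-- All values of `cap_q(K) / cap_p(K)`, where `K` ranges over the compact subsets of `ℝⁿ`
with more than one point. -/
def rieszCapacityRatios (n : ℕ) (p q : ℝ) : Set ℝ :=
  {r | ∃ K : Set (EuclideanSpace ℝ (Fin n)),
    IsCompact K ∧ K.Nontrivial ∧ r = rieszCapacity q K / rieszCapacity p K}

/-- `T` is the set of vertices of a (nondegenerate) equilateral triangle. -/
def IsRegularThreePointSet {n : ℕ} (T : Set (EuclideanSpace ℝ (Fin n))) : Prop :=
  ∃ (a b c : EuclideanSpace ℝ (Fin n)) (d : ℝ), 0 < d ∧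
    dist a b = d ∧ dist b c = d ∧ dist c a = d ∧ T = {a, b, c}

/-- For compact `K` and `p < 0` the supremum defining the energy is taken over a bounded set. -/
theorem bddAbove_rieszEnergyValues {n : ℕ} {p : ℝ} (hp : p < 0)
    {K : Set (EuclideanSpace ℝ (Fin n))} (hK : IsCompact K) :
    BddAbove (rieszEnergyValues p K) := by
  refine ⟨Metric.diam K ^ (-p), ?_⟩
  rintro E ⟨μ, hμ, hμK, rfl⟩
  have hae : ∀ᵐ x ∂μ, x ∈ K := hμK
  have hD : 0 ≤ Metric.diam K ^ (-p) := Real.rpow_nonneg Metric.diam_nonneg _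
  have bound : ∀ x ∈ K, ‖∫ y, dist x y ^ (-p) ∂μ‖ ≤ Metric.diam K ^ (-p) := by
    intro x hx
    have h := norm_integral_le_of_norm_le_const (μ := μ) (f := fun y => dist x y ^ (-p))
      (C := Metric.diam K ^ (-p)) (by
        filter_upwards [hae] with y hy
        rw [Real.norm_of_nonneg (Real.rpow_nonneg dist_nonneg _)]
        exact Real.rpow_le_rpow dist_nonneg
          (Metric.dist_le_diam_of_mem hK.isBounded hx hy) (by linarith))
    simpa using h
  have h := norm_integral_le_of_norm_le_const (μ := μ)
    (f := fun x => ∫ y, dist x y ^ (-p) ∂μ) (C := Metric.diam K ^ (-p)) (by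
      filter_upwards [hae] with x hx using bound x hx)
  exact (le_abs_self _).trans (by simpa [rieszDoubleIntegral] using h)

/-- The Riesz double integral of the measure with mass `1/2` at each of two points. -/
theorem rieszDoubleIntegral_two_point {n : ℕ} {p : ℝ} (hp : p < 0)
    (a b : EuclideanSpace ℝ (Fin n)) :
    rieszDoubleIntegral p
      ((2⁻¹ : ENNReal) • Measure.dirac a + (2⁻¹ : ENNReal) • Measure.dirac b) =
        dist a b ^ (-p) / 2 := by
  have key : ∀ f : EuclideanSpace ℝ (Fin n) → ℝ,
      ∫ x, f x ∂((2⁻¹ : ENNReal) • Measure.dirac a + (2⁻¹ : ENNReal) • Measure.dirac b) =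
        (f a + f b) / 2 := by
    intro f
    have hi : ∀ c, Integrable f ((2⁻¹ : ENNReal) • Measure.dirac c) := fun c =>
      (integrable_dirac (by simp)).smul_measure (by simp)
    rw [integral_add_measure (hi a) (hi b)]
    simp [integral_smul_measure]
    ring
  unfold rieszDoubleIntegral
  rw [key]
  simp only [key]
  rw [dist_self, dist_self, dist_comm b a, Real.zero_rpow (by linarith)]
  ring

/-- For `p < 0`, a compact set with more than one point has positive `p`-capacity, so that
quotients of such capacities are meaningful. -/
theorem rieszCapacity_pos {n : ℕ} {p : ℝ} (hp : p < 0)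
    {K : Set (EuclideanSpace ℝ (Fin n))} (hK : IsCompact K) (hK' : K.Nontrivial) :
    0 < rieszCapacity p K := by
  obtain ⟨a, ha, b, hb, hab⟩ := hK'
  refine Real.rpow_pos_of_pos ?_ _
  refine lt_of_lt_of_le ?_ (le_csSup (bddAbove_rieszEnergyValues hp hK)
    ⟨(2⁻¹ : ENNReal) • Measure.dirac a + (2⁻¹ : ENNReal) • Measure.dirac b, ⟨?_⟩, ?_, rfl⟩)
  · rw [rieszDoubleIntegral_two_point hp]
    have := Real.rpow_pos_of_pos (dist_pos.2 hab) (-p)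
    linarith
  · simp [ENNReal.inv_two_add_inv_two]
  · simp [ha, hb, hK.measurableSet]

open Filter Topology Set

/-! Write `s = -p` and `t = -q`. (a) Finitely supported measures suffice to bound the energy `V_q`
(`rieszDoubleIntegral_le_of_forall_finset`). On a finite set, take weights maximizing the double sum
of `|x - y|ᵗ`. If `t > 2`, the second-order condition makes this kernel conditionally negative
semidefinite on the support, so by Schoenberg its power `2 / t < 1`, which is `|x - y|²`, has
nonvanishing form on nonzero zero-sum weights (`sum_mul_rpow_ne_zero`). But that form is `-2 |∑ lᵢ
xᵢ|²`, so the support is affinely independent: at most three points in the plane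
(`card_support_le_of_isMaxOn`). Three weights leave mass at most `2/3` off the diagonal, and
Hölder's inequality on the off-diagonal pairs gives `V_q ≤ (2/3)^(1 - t/s) V_p^(t/s)`; the case `t =
2` is a limit. Equality holds for the equilateral triangle, where all off-diagonal distances agree.
(b) Half masses at two points of `K` show `|x - y|^(-p) ≤ 2 V_p`. Splitting off the factor `|x -
y|^(p - q)` and bounding it in this way gives `2 V_q ≤ (2 V_p)^(q/p)`, with equality for two points
(`rieszEnergy_le_of_lt`). -/

/-! ### Schoenberg's theorems on exponentials and powers of kernels -/

/-- If `A` is positive semidefinite, then so is its entrywise exponential. -/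
theorem posSemidef_entrywise_exp {ι : Type*} [Fintype ι] {A : Matrix ι ι ℝ}
    (hA : A.PosSemidef) : (A.map Real.exp).PosSemidef := by
  -- Schur's product theorem handles entrywise powers; the exponential is a limit of their
  -- nonnegative combinations.
  have hpow : ∀ k : ℕ, (A.map (· ^ k)).PosSemidef := by
    intro k
    induction k with
    | zero =>
      convert Matrix.posSemidef_vecMulVec_self_star (fun _ : ι => (1 : ℝ)) using 1
      ext i j
      simp [Matrix.vecMulVec]
    | succ k ih =>
      have e : A.map (· ^ (k + 1)) = (A.map (· ^ k)).hadamard A := by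
        ext i j
        simp [pow_succ]
      rw [e]
      exact ih.hadamard hA
  have hpart : ∀ N : ℕ, (∑ k ∈ Finset.range N, ((k.factorial : ℝ)⁻¹) • A.map (· ^ k)).PosSemidef :=
    fun N => Matrix.posSemidef_sum _ fun k _ => (hpow k).smul (by positivity)
  have hlim : ∀ i j, Tendsto
      (fun N => (∑ k ∈ Finset.range N, ((k.factorial : ℝ)⁻¹) • A.map (· ^ k)) i j) atTop
      (𝓝 (Real.exp (A i j))) := by
    intro i j
    have h := (NormedSpace.expSeries_div_hasSum_exp (𝔸 := ℝ) (A i j)).tendsto_sum_nat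
    rw [← Real.exp_eq_exp_ℝ] at h
    refine h.congr fun N => ?_
    simp [Matrix.sum_apply, div_eq_inv_mul]
  refine Matrix.PosSemidef.of_dotProduct_mulVec_nonneg ?_ fun x => ?_
  · exact hA.isHermitian.map _ fun _ => rfl
  · refine ge_of_tendsto (x := atTop) (f := fun N : ℕ => star x ⬝ᵥ
      (∑ k ∈ Finset.range N, ((k.factorial : ℝ)⁻¹) • A.map (· ^ k)).mulVec x) ?_
      (Eventually.of_forall fun N => (hpart N).dotProduct_mulVec_nonneg x)
    simp only [dotProduct, Matrix.mulVec]
    exact tendsto_finsetSum _ fun i _ => tendsto_const_nhds.mul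
      (tendsto_finsetSum _ fun j _ => (hlim i j).mul tendsto_const_nhds)

/-- Schoenberg: if a symmetric kernel `M` with zero diagonal is conditionally negative
semidefinite, then `exp (-M)` is positive semidefinite. -/
theorem sum_mul_exp_neg_nonneg {ι : Type*} [Fintype ι] {M : ι → ι → ℝ}
    (hsymm : ∀ i j, M i j = M j i) (hdiag : ∀ i, M i i = 0)
    (hneg : ∀ l : ι → ℝ, ∑ i, l i = 0 → ∑ i, ∑ j, l i * l j * M i j ≤ 0) (l : ι → ℝ) :
    0 ≤ ∑ i, ∑ j, l i * l j * Real.exp (-M i j) := by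
  classical
  rcases isEmpty_or_nonempty ι with h | ⟨⟨o⟩⟩
  · simp
  have hG : (Matrix.of fun i j => M i o + M j o - M i j).PosSemidef := by
    refine Matrix.PosSemidef.of_dotProduct_mulVec_nonneg ?_ fun x => ?_
    · ext i j
      simp [hsymm j i]
      ring
    -- Subtracting the total mass of `x` at the base point `o` makes it zero-sum without changing
    -- the form of the matrix, whose row and column at `o` vanish.
    · have h := hneg (fun i => x i - if i = o then ∑ k, x k else 0) (by simp)
      have e : ∑ i, ∑ j, (x i - if i = o then ∑ k, x k else 0) *
          (x j - if j = o then ∑ k, x k else 0) * M i j =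
          -(star x ⬝ᵥ (Matrix.of fun i j => M i o + M j o - M i j).mulVec x) := by
        simp only [sub_mul, mul_sub, ite_mul, mul_ite, zero_mul, mul_zero,
          Finset.sum_sub_distrib, Finset.sum_ite_eq', Finset.mem_univ, if_true,
          dotProduct, Matrix.mulVec, Matrix.of_apply, Pi.star_apply, star_trivial, add_mul, mul_add,
          Finset.sum_add_distrib, Finset.mul_sum, Finset.sum_mul]
        have e1 : ∑ i, ∑ j, x i * (M i o * x j) = ∑ i, ∑ k, x i * x k * M i o :=
          Finset.sum_congr rfl fun i _ => Finset.sum_congr rfl fun j _ => by ring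
        have e2 : ∑ i, ∑ j, x i * (M j o * x j) = ∑ j, ∑ k, x k * x j * M o j := by
          rw [Finset.sum_comm]
          exact Finset.sum_congr rfl fun i _ => Finset.sum_congr rfl fun j _ => by
            rw [hsymm o i]; ring
        have e3 : ∑ i, ∑ j, x i * (M i j * x j) = ∑ i, ∑ j, x i * x j * M i j :=
          Finset.sum_congr rfl fun i _ => Finset.sum_congr rfl fun j _ => by ring
        rw [e1, e2, e3]
        simp [hdiag]
        ring
      linarith
  -- `exp (-M i j)` is the exponential of the matrix in `hG`, rescaled by `exp (-M i o)` and `exp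
  -- (-M j o)`.
  have h := (posSemidef_entrywise_exp hG).dotProduct_mulVec_nonneg
    (fun i => l i * Real.exp (-M i o))
  refine h.trans_eq ?_
  simp only [dotProduct, Matrix.mulVec, Finset.mul_sum, Pi.star_apply, star_trivial,
    Matrix.map_apply, Matrix.of_apply]
  refine Finset.sum_congr rfl fun i _ => Finset.sum_congr rfl fun j _ => ?_
  rw [show -M i j = -M i o + (M i o + M j o - M i j) + -M j o by ring, Real.exp_add, Real.exp_add]
  ring

/-- Near `0` the integrand is at most `z * u ^ (-r)`, integrable as `r < 1`; at infinity it is at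
most `u ^ (-1 - r)`, integrable as `r > 0`. -/
theorem integrableOn_one_sub_exp_neg_mul_rpow {r : ℝ} (h0 : 0 < r) (h1 : r < 1) {z : ℝ}
    (hz : 0 ≤ z) :
    IntegrableOn (fun u : ℝ => (1 - Real.exp (-(u * z))) * u ^ (-1 - r)) (Ioi 0) := by
  have hm : ∀ s : Set ℝ, AEStronglyMeasurable
      (fun u : ℝ => (1 - Real.exp (-(u * z))) * u ^ (-1 - r)) (volume.restrict s) := fun s =>
    Measurable.aestronglyMeasurable (by fun_prop)
  have hle : ∀ u : ℝ, 0 < u → 0 ≤ 1 - Real.exp (-(u * z)) := fun u hu => by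
    have : Real.exp (-(u * z)) ≤ 1 := Real.exp_le_one_iff.2 (by nlinarith)
    linarith
  rw [← Ioc_union_Ioi_eq_Ioi zero_le_one]
  refine IntegrableOn.union ?_ ?_
  · have h : IntegrableOn (fun u : ℝ => z * u ^ (-r)) (Ioc 0 1) :=
      ((intervalIntegrable_iff_integrableOn_Ioc_of_le zero_le_one).1
        (intervalIntegral.intervalIntegrable_rpow' (by linarith))).const_mul z
    refine h.mono' (hm _) ?_
    refine (ae_restrict_iff' measurableSet_Ioc).2 (Eventually.of_forall fun u hu => ?_)
    have hp := Real.rpow_nonneg hu.1.le (-1 - r)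
    rw [Real.norm_of_nonneg (mul_nonneg (hle u hu.1) hp)]
    have hexp : 1 - Real.exp (-(u * z)) ≤ u * z := by
      linarith [Real.add_one_le_exp (-(u * z))]
    calc _ ≤ u * z * u ^ (-1 - r) := mul_le_mul_of_nonneg_right hexp hp
      _ = z * u ^ (-r) := by
        rw [show -r = 1 + (-1 - r) by ring, Real.rpow_add hu.1, Real.rpow_one]
        ring
  · have h : IntegrableOn (fun u : ℝ => u ^ (-1 - r)) (Ioi 1) :=
      integrableOn_Ioi_rpow_of_lt (by linarith) one_pos
    refine h.mono' (hm _) ?_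
    refine (ae_restrict_iff' measurableSet_Ioi).2 (Eventually.of_forall fun u hu => ?_)
    have hu' : 0 < u := one_pos.trans hu
    have hp := Real.rpow_nonneg hu'.le (-1 - r)
    rw [Real.norm_of_nonneg (mul_nonneg (hle u hu') hp)]
    exact mul_le_of_le_one_left hp (by linarith [Real.exp_pos (-(u * z))])

/-- By scaling `u`. This writes `z ^ r`, up to a constant, as a mixture of the functions `1 - exp
(-u z)`, which reduces powers to exponentials. -/
theorem integral_one_sub_exp_neg_mul_rpow {r : ℝ} (h0 : 0 < r) {z : ℝ} (hz : 0 ≤ z) :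
    ∫ u in Ioi (0 : ℝ), (1 - Real.exp (-(u * z))) * u ^ (-1 - r) =
      z ^ r * ∫ u in Ioi (0 : ℝ), (1 - Real.exp (-u)) * u ^ (-1 - r) := by
  rcases hz.eq_or_lt with rfl | hz
  · simp [Real.zero_rpow h0.ne']
  have h := integral_comp_mul_right_Ioi
    (fun u : ℝ => (1 - Real.exp (-u)) * u ^ (-1 - r)) 0 hz
  rw [zero_mul, smul_eq_mul] at h
  rw [show z ^ r = z ^ (1 + r) * z⁻¹ by
    rw [Real.rpow_add hz, Real.rpow_one]; field_simp, mul_assoc, ← h, ← integral_const_mul]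
  refine setIntegral_congr_fun measurableSet_Ioi fun u hu => ?_
  have hu : 0 < u := hu
  rw [Real.mul_rpow hu.le hz.le]
  have : z ^ (1 + r) * z ^ (-1 - r) = 1 := by
    rw [← Real.rpow_add hz]; ring_nf; simp
  linear_combination -((1 - Real.exp (-(u * z))) * u ^ (-1 - r)) * this

/-- Strict form of Schoenberg's theorem on powers: raising a conditionally negative semidefinite
kernel, positive off the diagonal, to a power `0 < r < 1` makes it conditionally negative
definite. -/
theorem sum_mul_rpow_ne_zero {ι : Type*} [Fintype ι] {M : ι → ι → ℝ}
    (hsymm : ∀ i j, M i j = M j i) (hdiag : ∀ i, M i i = 0) (hpos : ∀ i j, i ≠ j → 0 < M i j)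
    (hneg : ∀ l : ι → ℝ, ∑ i, l i = 0 → ∑ i, ∑ j, l i * l j * M i j ≤ 0)
    {r : ℝ} (h0 : 0 < r) (h1 : r < 1) {l : ι → ℝ} (hl : ∑ i, l i = 0) (hne : l ≠ 0) :
    ∑ i, ∑ j, l i * l j * M i j ^ r ≠ 0 := by
  classical
  have hM : ∀ i j, 0 ≤ M i j := fun i j => by
    rcases eq_or_ne i j with rfl | h
    · rw [hdiag]
    · exact (hpos i j h).le
  -- As `l` is zero-sum, the constant `1` in `1 - exp (-u M)` contributes nothing, so only the
  -- exponential form remains, and it is nonnegative.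
  set f : ℝ → ℝ := fun u => (∑ i, ∑ j, l i * l j * Real.exp (-(u * M i j))) * u ^ (-1 - r) with hf
  have hll : ∑ i, ∑ j, l i * l j = 0 := by
    simp only [← Finset.mul_sum, hl, mul_zero, Finset.sum_const_zero]
  have hfeq : ∀ u, f u = ∑ i, ∑ j, -(l i * l j) *
      ((1 - Real.exp (-(u * M i j))) * u ^ (-1 - r)) := by
    intro u
    have : ∑ i, ∑ j, -(l i * l j) * ((1 - Real.exp (-(u * M i j))) * u ^ (-1 - r)) =
        ∑ i, ∑ j, (l i * l j * Real.exp (-(u * M i j)) * u ^ (-1 - r) -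
          l i * l j * u ^ (-1 - r)) :=
      Finset.sum_congr rfl fun i _ => Finset.sum_congr rfl fun j _ => by ring
    rw [this]
    simp only [Finset.sum_sub_distrib, ← Finset.sum_mul, hll, zero_mul, sub_zero, hf]
  have hint : ∀ i j, IntegrableOn (fun u : ℝ => -(l i * l j) *
      ((1 - Real.exp (-(u * M i j))) * u ^ (-1 - r))) (Ioi 0) := fun i j =>
    (integrableOn_one_sub_exp_neg_mul_rpow h0 h1 (hM i j)).const_mul _
  have hfint : IntegrableOn f (Ioi 0) := by
    rw [show f = _ from funext hfeq]
    exact integrable_finsetSum _ fun i _ => integrable_finsetSum _ fun j _ => hint i j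
  have hfnn : ∀ u ∈ Ioi (0 : ℝ), 0 ≤ f u := fun u hu => by
    have hu : 0 < u := hu
    refine mul_nonneg (sum_mul_exp_neg_nonneg (M := fun i j => u * M i j)
      (fun i j => by rw [hsymm]) (fun i => by simp [hdiag]) (fun w hw => ?_) l)
      (Real.rpow_nonneg hu.le _)
    have e : ∑ i, ∑ j, w i * w j * (u * M i j) = u * ∑ i, ∑ j, w i * w j * M i j := by
      simp only [Finset.mul_sum]
      exact Finset.sum_congr rfl fun i _ => Finset.sum_congr rfl fun j _ => by ring
    rw [e]
    exact mul_nonpos_of_nonneg_of_nonpos hu.le (hneg w hw)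
  have hfint_eq : ∫ u in Ioi (0 : ℝ), f u =
      -(∑ i, ∑ j, l i * l j * M i j ^ r) *
        ∫ u in Ioi (0 : ℝ), (1 - Real.exp (-u)) * u ^ (-1 - r) := by
    rw [show f = _ from funext hfeq, integral_finsetSum _ fun i _ =>
      integrable_finsetSum _ fun j _ => hint i j]
    simp only [integral_finsetSum _ fun j _ => hint _ j, integral_const_mul]
    rw [← Finset.sum_neg_distrib, Finset.sum_mul]
    refine Finset.sum_congr rfl fun i _ => ?_
    rw [← Finset.sum_neg_distrib, Finset.sum_mul]
    refine Finset.sum_congr rfl fun j _ => ?_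
    rw [integral_one_sub_exp_neg_mul_rpow h0 (hM i j)]
    ring
  -- For large `u` only the diagonal survives, so `f` is eventually positive and its integral is not
  -- zero.
  have htend : Tendsto (fun u : ℝ => ∑ i, ∑ j, l i * l j * Real.exp (-(u * M i j))) atTop
      (𝓝 (∑ i, l i ^ 2)) := by
    have e : ∑ i, l i ^ 2 = ∑ i, ∑ j, l i * l j * (if i = j then 1 else 0) := by
      simp [sq]
    rw [e]
    refine tendsto_finsetSum _ fun i _ => tendsto_finsetSum _ fun j _ =>
      tendsto_const_nhds.mul ?_
    split_ifs with h
    · subst h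
      simp [hdiag]
    · exact Real.tendsto_exp_neg_atTop_nhds_zero.comp (tendsto_id.atTop_mul_const (hpos i j h))
  have hsq : 0 < ∑ i, l i ^ 2 := by
    obtain ⟨i, hi⟩ := Function.ne_iff.1 hne
    exact Finset.sum_pos' (fun i _ => sq_nonneg _) ⟨i, Finset.mem_univ _, sq_pos_of_ne_zero hi⟩
  obtain ⟨R, hR⟩ := eventually_atTop.1 (htend.eventually (lt_mem_nhds hsq))
  have hIpos : 0 < ∫ u in Ioi (0 : ℝ), f u := by
    refine (setIntegral_pos_iff_support_of_nonneg_ae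
      ((ae_restrict_iff' measurableSet_Ioi).2 (Eventually.of_forall hfnn)) hfint).2 ?_
    refine lt_of_lt_of_le ?_ (measure_mono (s := Ioi (max R 0)) fun u hu => ?_)
    · simp
    · have hu0 : 0 < u := (le_max_right R 0).trans_lt hu
      exact ⟨(mul_pos (hR u ((le_max_left R 0).trans (le_of_lt hu)))
        (Real.rpow_pos_of_pos hu0 _)).ne', hu0⟩
  intro h
  rw [hfint_eq, h] at hIpos
  simp at hIpos

/-! ### Double sums and the support of their maximizers -/

/-- The Riesz double sum `∑ᵢⱼ wᵢ wⱼ |xᵢ - xⱼ|ˢ` of points `x` with weights `w`. -/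
noncomputable def rieszForm {n : ℕ} {ι : Type*} [Fintype ι] (s : ℝ)
    (x : ι → EuclideanSpace ℝ (Fin n)) (w : ι → ℝ) : ℝ :=
  ∑ i, ∑ j, w i * w j * dist (x i) (x j) ^ s

section

variable {n : ℕ} {ι : Type*} [Fintype ι] {x : ι → EuclideanSpace ℝ (Fin n)}

theorem rieszForm_nonneg {s : ℝ} {w : ι → ℝ} (hw : ∀ i, 0 ≤ w i) : 0 ≤ rieszForm s x w :=
  Finset.sum_nonneg fun i _ => Finset.sum_nonneg fun j _ =>
    mul_nonneg (mul_nonneg (hw i) (hw j)) (Real.rpow_nonneg dist_nonneg _)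

theorem rieszForm_add_add_rieszForm_sub (s : ℝ) (w l : ι → ℝ) :
    rieszForm s x (w + l) + rieszForm s x (w - l) =
      2 * rieszForm s x w + 2 * rieszForm s x l := by
  simp only [rieszForm, Finset.mul_sum, ← Finset.sum_add_distrib, Pi.add_apply, Pi.sub_apply]
  exact Finset.sum_congr rfl fun i _ => Finset.sum_congr rfl fun j _ => by ring

theorem rieszForm_smul (s c : ℝ) (l : ι → ℝ) :
    rieszForm s x (c • l) = c ^ 2 * rieszForm s x l := by
  simp only [rieszForm, Finset.mul_sum, Pi.smul_apply, smul_eq_mul]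
  exact Finset.sum_congr rfl fun i _ => Finset.sum_congr rfl fun j _ => by ring

/-- The second-order condition at a maximizer of the form over the simplex. -/
theorem rieszForm_nonpos_of_isMaxOn {s : ℝ} {w : ι → ℝ} (hw : w ∈ stdSimplex ℝ ι)
    (hmax : IsMaxOn (rieszForm s x) (stdSimplex ℝ ι) w) {l : ι → ℝ} (hl : ∑ i, l i = 0)
    (hsupp : ∀ i, w i = 0 → l i = 0) : rieszForm s x l ≤ 0 := by
  -- As `l` vanishes where `w` does, `w ± e l` stays in the simplex for small `e`. Adding the two
  -- maximality inequalities cancels the linear term.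
  have hev : ∀ᶠ e in 𝓝[>] (0 : ℝ), ∀ i, e * |l i| ≤ w i := by
    refine eventually_all.2 fun i => ?_
    rcases (hw.1 i).eq_or_lt with h | h
    · simp [← h, hsupp i h.symm]
    · have : Tendsto (fun e : ℝ => e * |l i|) (𝓝[>] 0) (𝓝 0) := by
        have : Tendsto (fun e : ℝ => e * |l i|) (𝓝 0) (𝓝 (0 * |l i|)) :=
          tendsto_id.mul tendsto_const_nhds
        rw [zero_mul] at this
        exact this.mono_left nhdsWithin_le_nhds
      exact (this.eventually (gt_mem_nhds h)).mono fun _ h => h.le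
  obtain ⟨e, he, he0⟩ := (hev.and self_mem_nhdsWithin).exists
  have he0 : 0 < e := he0
  have hb : ∀ i, |e * l i| ≤ w i := fun i => by
    rw [abs_mul, abs_of_pos he0]
    exact he i
  have h1 : w + e • l ∈ stdSimplex ℝ ι := by
    refine ⟨fun i => ?_, ?_⟩
    · simp only [Pi.add_apply, Pi.smul_apply, smul_eq_mul]
      linarith [(abs_le.1 (hb i)).1]
    · simp [Finset.sum_add_distrib, ← Finset.mul_sum, hl, hw.2]
  have h2 : w - e • l ∈ stdSimplex ℝ ι := by
    refine ⟨fun i => ?_, ?_⟩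
    · simp only [Pi.sub_apply, Pi.smul_apply, smul_eq_mul]
      linarith [(abs_le.1 (hb i)).2]
    · simp [Finset.sum_sub_distrib, ← Finset.mul_sum, hl, hw.2]
  have h3 : rieszForm s x (w + e • l) ≤ rieszForm s x w := hmax h1
  have h4 : rieszForm s x (w - e • l) ≤ rieszForm s x w := hmax h2
  have h5 := rieszForm_add_add_rieszForm_sub (x := x) s w (e • l)
  rw [rieszForm_smul] at h5
  have : 0 < e ^ 2 := by positivity
  by_contra! h
  nlinarith [mul_pos this h]

/-- Expanding the square, the terms `‖x i‖ ^ 2` and `‖x j‖ ^ 2` are killed by the zero sum. Hence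
the form vanishes exactly at affine dependences. -/
theorem rieszForm_two (l : ι → ℝ) (hl : ∑ i, l i = 0) :
    rieszForm 2 x l = -2 * ‖∑ i, l i • x i‖ ^ 2 := by
  have h1 : ‖∑ i, l i • x i‖ ^ 2 = ∑ i, ∑ j, l i * l j * inner ℝ (x i) (x j) := by
    rw [← real_inner_self_eq_norm_sq, sum_inner]
    refine Finset.sum_congr rfl fun i _ => ?_
    rw [inner_sum]
    refine Finset.sum_congr rfl fun j _ => ?_
    rw [real_inner_smul_left, real_inner_smul_right]
    ring
  have h2 : ∑ i, ∑ j, l i * l j * ‖x i‖ ^ 2 = 0 := by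
    have : ∀ i, ∑ j, l i * l j * ‖x i‖ ^ 2 = 0 := fun i => by
      rw [← Finset.sum_mul, ← Finset.mul_sum, hl]
      simp
    simp [this]
  have h3 : ∑ i, ∑ j, l i * l j * ‖x j‖ ^ 2 = 0 := by
    rw [Finset.sum_comm, ← h2]
    exact Finset.sum_congr rfl fun i _ => Finset.sum_congr rfl fun j _ => by ring
  have h4 : rieszForm 2 x l = ∑ i, ∑ j, l i * l j * ‖x i‖ ^ 2 +
      ∑ i, ∑ j, l i * l j * ‖x j‖ ^ 2 - 2 * ∑ i, ∑ j, l i * l j * inner ℝ (x i) (x j) := by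
    simp only [rieszForm, Finset.mul_sum, ← Finset.sum_add_distrib, ← Finset.sum_sub_distrib]
    refine Finset.sum_congr rfl fun i _ => Finset.sum_congr rfl fun j _ => ?_
    rw [Real.rpow_two, dist_eq_norm, norm_sub_sq_real]
    ring
  rw [h4, h2, h3, h1]
  ring

/-- Points with conditionally negative semidefinite kernel `|x - y|ᵗ`, where `t > 2`, are affinely
independent. -/
theorem affineIndependent_of_rieszForm_nonpos {t : ℝ} (ht : 2 < t) (hx : Function.Injective x)
    (hneg : ∀ l : ι → ℝ, ∑ i, l i = 0 → rieszForm t x l ≤ 0) : AffineIndependent ℝ x := by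
  rw [affineIndependent_iff_of_fintype]
  intro l hl hlx
  rw [Finset.univ.weightedVSub_eq_linear_combination hl] at hlx
  by_contra! hne
  have h := sum_mul_rpow_ne_zero (M := fun i j => dist (x i) (x j) ^ t)
    (fun i j => by rw [dist_comm]) (fun i => by rw [dist_self, Real.zero_rpow (by linarith)])
    (fun i j hij => Real.rpow_pos_of_pos (dist_pos.2 (hx.ne hij)) _) hneg
    (r := 2 / t) (by positivity) ((div_lt_one (by linarith)).2 ht) hl
    (Function.ne_iff.2 hne)
  apply h
  have h2 := rieszForm_two (x := x) l hl
  rw [hlx] at h2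
  simp only [norm_zero, ne_eq, OfNat.ofNat_ne_zero, not_false_eq_true, zero_pow, mul_zero] at h2
  rw [← h2]
  refine Finset.sum_congr rfl fun i _ => Finset.sum_congr rfl fun j _ => ?_
  rw [← Real.rpow_mul dist_nonneg, mul_div_cancel₀ _ (by linarith)]

/-- Björck: for `t > 2`, a maximizer of the double sum charges at most `n + 1` points. -/
theorem card_support_le_of_isMaxOn {t : ℝ} (ht : 2 < t) (hx : Function.Injective x) {w : ι → ℝ}
    (hw : w ∈ stdSimplex ℝ ι) (hmax : IsMaxOn (rieszForm t x) (stdSimplex ℝ ι) w) :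
    Fintype.card {i // w i ≠ 0} ≤ n + 1 := by
  classical
  have hsum : ∀ G : ι → ℝ, (∀ i, w i = 0 → G i = 0) →
      ∑ i, G i = ∑ j : {i // w i ≠ 0}, G j := by
    intro G hG
    rw [← Finset.sum_filter_of_ne (p := fun i => w i ≠ 0) fun i _ h h' => h (hG i h')]
    exact Finset.sum_subtype _ (by simp) _
  have hind : AffineIndependent ℝ (fun j : {i // w i ≠ 0} => x j) := by
    refine affineIndependent_of_rieszForm_nonpos ht (hx.comp Subtype.val_injective) fun l hl => ?_
    -- Extension by zero gives a direction to which the second-order condition applies.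
    set g : ι → ℝ := fun i => if h : w i ≠ 0 then l ⟨i, h⟩ else 0 with hg
    have hg0 : ∀ i, w i = 0 → g i = 0 := fun i h => by simp [hg, h]
    have hgl : ∀ j : {i // w i ≠ 0}, l j = g j := fun j => by simp [hg, j.2]
    have h1 := rieszForm_nonpos_of_isMaxOn hw hmax (l := g)
      ((hsum g hg0).trans ((Finset.sum_congr rfl fun j _ => (hgl j).symm).trans hl)) hg0
    have h2 : rieszForm t x g = rieszForm t (fun j : {i // w i ≠ 0} => x j) l := by
      rw [rieszForm, hsum _ fun i h => by simp [hg0 i h]]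
      refine Finset.sum_congr rfl fun i _ => ?_
      rw [hsum _ fun j h => by simp [hg0 j h]]
      exact Finset.sum_congr rfl fun j _ => by rw [hgl, hgl]
    rwa [← h2]
  refine hind.card_le_finrank_succ.trans ?_
  have := (vectorSpan ℝ (Set.range fun j : {i // w i ≠ 0} => x j)).finrank_le
  rw [finrank_euclideanSpace_fin] at this
  omega

/-! ### Hölder comparison of double sums -/

theorem sum_ite_mul_eq_one_sub [DecidableEq ι] {w : ι → ℝ} (hw : w ∈ stdSimplex ℝ ι) :
    ∑ z : ι × ι, (if z.1 = z.2 then 0 else w z.1 * w z.2) = 1 - ∑ i, w i ^ 2 := by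
  have : ∀ i j, (if i = j then 0 else w i * w j) = w i * w j - if i = j then w i * w j else 0 :=
    fun i j => by split_ifs <;> simp
  rw [Fintype.sum_prod_type]
  simp only [this, Finset.sum_sub_distrib, ← Finset.mul_sum, hw.2, Finset.sum_ite_eq,
    Finset.mem_univ, if_true, mul_one, sq]

/-- Cauchy–Schwarz on the support of `w`. -/
theorem one_sub_sum_sq_le {w : ι → ℝ} (hw : w ∈ stdSimplex ℝ ι) {N : ℕ}
    (hN : Fintype.card {i // w i ≠ 0} ≤ N + 1) : 1 - ∑ i, w i ^ 2 ≤ (N / (N + 1) : ℝ) := by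
  have hsq : (1 : ℝ) ≤ (N + 1) * ∑ i, w i ^ 2 := by
    have h := sq_sum_le_card_mul_sum_sq (s := Finset.univ.filter fun i => w i ≠ 0) (f := w)
    rw [Finset.sum_filter_ne_zero, hw.2, one_pow,
      Finset.sum_filter_of_ne (f := fun i => w i ^ 2) (p := fun i => w i ≠ 0)
        fun i _ h h' => h (by simp [h'])] at h
    refine h.trans (mul_le_mul_of_nonneg_right ?_ (Finset.sum_nonneg fun i _ => sq_nonneg _))
    rw [← Fintype.card_subtype]
    exact_mod_cast hN
  rw [le_div_iff₀ (by positivity)]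
  linarith

/-- Hölder's inequality for the double sums of at most `n + 1` points. -/
theorem rieszForm_le_of_card_support_le {s t : ℝ} (ht : 0 < t) (hts : t ≤ s) {w : ι → ℝ}
    (hw : w ∈ stdSimplex ℝ ι) {N : ℕ} (hN : Fintype.card {i // w i ≠ 0} ≤ N + 1) :
    rieszForm t x w ≤ (N / (N + 1) : ℝ) ^ (1 - t / s) * rieszForm s x w ^ (t / s) := by
  classical
  have hs : 0 < s := ht.trans_le hts
  -- The diagonal does not contribute to the double sums, so it is dropped from the weights; the
  -- sharp constant comes from the mass lost.
  have key := Real.inner_le_weight_mul_Lp_of_nonneg (Finset.univ : Finset (ι × ι))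
    (p := s / t) ((one_le_div ht).2 hts) (fun z => if z.1 = z.2 then 0 else w z.1 * w z.2)
    (fun z => dist (x z.1) (x z.2) ^ t)
    (fun z => by
      split_ifs
      exacts [le_rfl, mul_nonneg (hw.1 _) (hw.1 _)])
    (fun z => Real.rpow_nonneg dist_nonneg _)
  have hform : ∀ r : ℝ, 0 < r → ∑ z : ι × ι, (if z.1 = z.2 then 0 else w z.1 * w z.2) *
      dist (x z.1) (x z.2) ^ r = rieszForm r x w := by
    intro r hr
    rw [Fintype.sum_prod_type, rieszForm]
    refine Finset.sum_congr rfl fun i _ => Finset.sum_congr rfl fun j _ => ?_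
    split_ifs with h
    · have h : i = j := h
      simp [h, Real.zero_rpow hr.ne']
    · rfl
  have hpow : ∀ z : ι × ι, (dist (x z.1) (x z.2) ^ t) ^ (s / t) = dist (x z.1) (x z.2) ^ s := by
    intro z
    rw [← Real.rpow_mul dist_nonneg, mul_div_cancel₀ _ ht.ne']
  simp only [hpow] at key
  rw [hform t ht, hform s hs, inv_div] at key
  refine key.trans ?_
  have hmass_nn : 0 ≤ ∑ z : ι × ι, (if z.1 = z.2 then 0 else w z.1 * w z.2) :=
    Finset.sum_nonneg fun z _ => by
      split_ifs
      exacts [le_rfl, mul_nonneg (hw.1 _) (hw.1 _)]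
  refine mul_le_mul_of_nonneg_right (Real.rpow_le_rpow hmass_nn ?_ ?_)
    (Real.rpow_nonneg (rieszForm_nonneg hw.1) _)
  · rw [sum_ite_mul_eq_one_sub hw]
    exact one_sub_sum_sq_le hw hN
  · rw [sub_nonneg]
    exact (div_le_one hs).2 hts

theorem rieszForm_eq_of_pairwise_dist_eq {s : ℝ} (hs : 0 < s) {d : ℝ}
    (hd : ∀ i j, i ≠ j → dist (x i) (x j) = d) {w : ι → ℝ} (hw : w ∈ stdSimplex ℝ ι) :
    rieszForm s x w = (1 - ∑ i, w i ^ 2) * d ^ s := by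
  classical
  rw [← sum_ite_mul_eq_one_sub hw, Finset.sum_mul, Fintype.sum_prod_type, rieszForm]
  refine Finset.sum_congr rfl fun i _ => Finset.sum_congr rfl fun j _ => ?_
  split_ifs with h
  · have h : i = j := h
    simp [h, Real.zero_rpow hs.ne']
  · rw [hd i j h]

theorem continuous_rieszForm (s : ℝ) : Continuous (rieszForm s x) := by
  unfold rieszForm
  fun_prop

theorem rieszForm_le_of_two_lt {s t : ℝ} (ht : 2 < t) (hts : t ≤ s) (hx : Function.Injective x)
    {B : ℝ} (hB : ∀ v ∈ stdSimplex ℝ ι, rieszForm s x v ≤ B) {w : ι → ℝ}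
    (hw : w ∈ stdSimplex ℝ ι) :
    rieszForm t x w ≤ (n / (n + 1) : ℝ) ^ (1 - t / s) * B ^ (t / s) := by
  obtain ⟨v, hv, hmax⟩ := (isCompact_stdSimplex ℝ ι).exists_isMaxOn ⟨w, hw⟩
    (continuous_rieszForm (x := x) t).continuousOn
  calc rieszForm t x w ≤ rieszForm t x v := hmax hw
    _ ≤ _ := rieszForm_le_of_card_support_le (by linarith) hts hv
      (card_support_le_of_isMaxOn ht hx hv hmax)
    _ ≤ _ := by
      refine mul_le_mul_of_nonneg_left (Real.rpow_le_rpow (rieszForm_nonneg hv.1) (hB v hv) ?_)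
        (Real.rpow_nonneg (by positivity) _)
      exact div_nonneg (by linarith) (by linarith)

/-- At `t = 2` the Schoenberg exponent `2 / t` would be `1`, so the bound is obtained by letting
exponents `r > t` decrease to `t`. -/
theorem rieszForm_le_of_two_le {s t : ℝ} (ht : 2 ≤ t) (hts : t < s) (hx : Function.Injective x)
    {B : ℝ} (hB : ∀ v ∈ stdSimplex ℝ ι, rieszForm s x v ≤ B) {w : ι → ℝ}
    (hw : w ∈ stdSimplex ℝ ι) :
    rieszForm t x w ≤ (n / (n + 1) : ℝ) ^ (1 - t / s) * B ^ (t / s) := by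
  have hs : 0 < s := by linarith
  have hev : ∀ᶠ r in 𝓝[>] t,
      rieszForm r x w ≤ (n / (n + 1) : ℝ) ^ (1 - r / s) * B ^ (r / s) := by
    filter_upwards [Ioo_mem_nhdsGT hts] with r hr
    exact rieszForm_le_of_two_lt (ht.trans_lt hr.1) hr.2.le hx hB hw
  -- The bases may be `0`, as diagonal distances are, so continuity in the exponent requires a
  -- nonzero limit exponent.
  have hcont : ∀ (c : ℝ) (f : ℝ → ℝ), Continuous f → f t ≠ 0 →
      Tendsto (fun r => c ^ f r) (𝓝[>] t) (𝓝 (c ^ f t)) := fun c f hf h =>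
    ((Real.continuousAt_const_rpow' h).tendsto.comp hf.continuousAt.tendsto).mono_left
      nhdsWithin_le_nhds
  refine le_of_tendsto_of_tendsto ?_ ?_ hev
  · exact tendsto_finsetSum _ fun i _ => tendsto_finsetSum _ fun j _ =>
      (hcont _ (fun r => r) continuous_id (by linarith)).const_mul _
  · refine (hcont _ (fun r => 1 - r / s) (by fun_prop) ?_).mul
      (hcont _ (fun r => r / s) (by fun_prop) ?_)
    · exact sub_ne_zero.2 ((div_lt_one hs).2 hts).ne'
    · exact (div_pos (by linarith) hs).ne'

end

/-! ### Reduction from measures to finite sums -/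

theorem rieszForm_mem_rieszEnergyValues {n : ℕ} {ι : Type*} [Fintype ι] {p : ℝ}
    {K : Set (EuclideanSpace ℝ (Fin n))} (hK : MeasurableSet K)
    {x : ι → EuclideanSpace ℝ (Fin n)} (hx : ∀ i, x i ∈ K) {w : ι → ℝ}
    (hw : w ∈ stdSimplex ℝ ι) : rieszForm (-p) x w ∈ rieszEnergyValues p K := by
  set μ : Measure (EuclideanSpace ℝ (Fin n)) :=
    ∑ i, ENNReal.ofReal (w i) • Measure.dirac (x i) with hμ
  have key : ∀ f : EuclideanSpace ℝ (Fin n) → ℝ, ∫ y, f y ∂μ = ∑ i, w i * f (x i) := by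
    intro f
    rw [hμ, integral_finsetSum_measure fun i _ =>
      (integrable_dirac (by simp)).smul_measure ENNReal.ofReal_ne_top]
    refine Finset.sum_congr rfl fun i _ => ?_
    rw [integral_smul_measure, integral_dirac, ENNReal.toReal_ofReal (hw.1 i), smul_eq_mul]
  refine ⟨μ, ⟨?_⟩, ?_, ?_⟩
  · simp [hμ, ← ENNReal.ofReal_sum_of_nonneg fun i _ => hw.1 i, hw.2]
  · simp [hμ, hK.compl, hx]
  · rw [rieszDoubleIntegral, key]
    simp only [key, rieszForm, Finset.mul_sum, mul_assoc]

theorem rieszForm_le_rieszEnergy {n : ℕ} {ι : Type*} [Fintype ι] {p : ℝ} (hp : p < 0)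
    {K : Set (EuclideanSpace ℝ (Fin n))} (hK : IsCompact K)
    {x : ι → EuclideanSpace ℝ (Fin n)} (hx : ∀ i, x i ∈ K) {w : ι → ℝ}
    (hw : w ∈ stdSimplex ℝ ι) : rieszForm (-p) x w ≤ rieszEnergy p K :=
  le_csSup (bddAbove_rieszEnergyValues hp hK)
    (rieszForm_mem_rieszEnergyValues hK.measurableSet hx hw)

/-- A probability measure carried by a finite set has a double sum as its double integral. -/
theorem exists_rieszDoubleIntegral_eq_rieszForm {n : ℕ} (p : ℝ)
    (F : Finset (EuclideanSpace ℝ (Fin n))) (ν : Measure (EuclideanSpace ℝ (Fin n)))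
    [IsProbabilityMeasure ν] (hν : ∀ᵐ x ∂ν, x ∈ F) :
    ∃ w ∈ stdSimplex ℝ F, rieszDoubleIntegral p ν =
      rieszForm (-p) (Subtype.val : F → EuclideanSpace ℝ (Fin n)) w := by
  have key : ∀ f : EuclideanSpace ℝ (Fin n) → ℝ,
      ∫ y, f y ∂ν = ∑ i : F, ν.real {i.1} * f i := by
    intro f
    have hr : ν.restrict (F : Set (EuclideanSpace ℝ (Fin n))) = ν :=
      Measure.restrict_eq_self_of_ae_mem hν
    rw [Finset.sum_coe_sort F fun i => ν.real {i} * f i]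
    conv_lhs => rw [← hr]
    rw [setIntegral_finset F (IntegrableOn.finset)]
    rfl
  refine ⟨fun i => ν.real {i.1}, ⟨fun i => measureReal_nonneg, ?_⟩, ?_⟩
  · simpa using (key fun _ => 1).symm
  · rw [rieszDoubleIntegral, key]
    simp only [key, rieszForm, Finset.mul_sum, mul_assoc]

theorem continuous_dist_rpow {n : ℕ} {p : ℝ} (hp : p < 0) :
    Continuous fun z : EuclideanSpace ℝ (Fin n) × EuclideanSpace ℝ (Fin n) =>
      dist z.1 z.2 ^ (-p) :=
  (continuous_fst.dist continuous_snd).rpow_const fun _ => Or.inr (by linarith)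

theorem rieszDoubleIntegral_map {n : ℕ} {p : ℝ} (hp : p < 0)
    (μ : Measure (EuclideanSpace ℝ (Fin n))) [IsProbabilityMeasure μ]
    {φ : EuclideanSpace ℝ (Fin n) → EuclideanSpace ℝ (Fin n)} (hφ : Measurable φ) :
    rieszDoubleIntegral p (μ.map φ) = ∫ x, ∫ y, dist (φ x) (φ y) ^ (-p) ∂μ ∂μ := by
  have := Measure.isProbabilityMeasure_map (μ := μ) hφ.aemeasurable
  have hint := (continuous_dist_rpow (n := n) hp).stronglyMeasurable.integral_prod_right'
    (ν := μ.map φ)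
  rw [rieszDoubleIntegral, integral_map hφ.aemeasurable hint.aestronglyMeasurable]
  refine integral_congr_ae (Eventually.of_forall fun x => ?_)
  exact integral_map hφ.aemeasurable
    ((continuous_dist_rpow hp).comp (Continuous.prodMk_right (φ x))).aestronglyMeasurable

/-- Dominated convergence, applied to the inner and then to the outer integral. -/
theorem tendsto_integral_integral_comp {X : Type*} [TopologicalSpace X] [MeasurableSpace X]
    [BorelSpace X] [SecondCountableTopology X] {g : X × X → ℝ} (hg : Continuous g) {K : Set X}
    {C : ℝ} (hC : ∀ x ∈ K, ∀ y ∈ K, ‖g (x, y)‖ ≤ C)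
    (μ : Measure X) [IsProbabilityMeasure μ] (hμ : ∀ᵐ x ∂μ, x ∈ K)
    {φ : ℕ → X → X} (hφ : ∀ k, Measurable (φ k))
    (hφK : ∀ k x, φ k x ∈ K) (hφlim : ∀ x ∈ K, Tendsto (fun k => φ k x) atTop (𝓝 x)) :
    Tendsto (fun k => ∫ x, ∫ y, g (φ k x, φ k y) ∂μ ∂μ) atTop (𝓝 (∫ x, ∫ y, g (x, y) ∂μ ∂μ)) := by
  have hmeas : ∀ k, StronglyMeasurable fun z : X × X => g (φ k z.1, φ k z.2) := fun k =>
    hg.stronglyMeasurable.comp_measurable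
      (((hφ k).comp measurable_fst).prodMk ((hφ k).comp measurable_snd))
  refine tendsto_integral_of_dominated_convergence (fun _ => C)
    (fun k => ((hmeas k).integral_prod_right' (ν := μ)).aestronglyMeasurable)
    (integrable_const _) (fun k => Eventually.of_forall fun x => ?_) ?_
  · have h := norm_integral_le_of_norm_le_const (μ := μ) (f := fun y => g (φ k x, φ k y))
      (Eventually.of_forall fun y => hC _ (hφK k x) _ (hφK k y))
    rwa [probReal_univ, mul_one] at h
  · filter_upwards [hμ] with x hx
    refine tendsto_integral_of_dominated_convergence (fun _ => C)
      (fun k => ((hmeas k).comp_measurable measurable_prodMk_left).aestronglyMeasurable)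
      (integrable_const _)
      (fun k => Eventually.of_forall fun y => hC _ (hφK k x) _ (hφK k y)) ?_
    filter_upwards [hμ] with y hy
    exact (hg.tendsto (x, y)).comp ((hφlim x hx).prodMk_nhds (hφlim y hy))

theorem tendsto_rieszDoubleIntegral_map {n : ℕ} {p : ℝ} (hp : p < 0)
    {K : Set (EuclideanSpace ℝ (Fin n))} (hK : IsCompact K)
    (μ : Measure (EuclideanSpace ℝ (Fin n))) [IsProbabilityMeasure μ] (hμ : ∀ᵐ x ∂μ, x ∈ K)
    {φ : ℕ → EuclideanSpace ℝ (Fin n) → EuclideanSpace ℝ (Fin n)} (hφ : ∀ k, Measurable (φ k))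
    (hφK : ∀ k x, φ k x ∈ K) (hφlim : ∀ x ∈ K, Tendsto (fun k => φ k x) atTop (𝓝 x)) :
    Tendsto (fun k => rieszDoubleIntegral p (μ.map (φ k))) atTop
      (𝓝 (rieszDoubleIntegral p μ)) := by
  refine (tendsto_integral_integral_comp (continuous_dist_rpow hp) (K := K)
    (C := Metric.diam K ^ (-p)) (fun x hx y hy => ?_) μ hμ hφ hφK hφlim).congr fun k =>
      (rieszDoubleIntegral_map hp μ (hφ k)).symm
  rw [Real.norm_of_nonneg (Real.rpow_nonneg dist_nonneg _)]
  exact Real.rpow_le_rpow dist_nonneg (Metric.dist_le_diam_of_mem hK.isBounded hx hy)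
    (by linarith)

/-- Finitely supported measures on a compact set suffice to compute its energy. -/
theorem rieszDoubleIntegral_le_of_forall_finset {n : ℕ} {p : ℝ} (hp : p < 0)
    {K : Set (EuclideanSpace ℝ (Fin n))} (hK : IsCompact K) {B : ℝ}
    (hB : ∀ F : Finset (EuclideanSpace ℝ (Fin n)), (∀ x ∈ F, x ∈ K) → ∀ w ∈ stdSimplex ℝ F,
      rieszForm (-p) (Subtype.val : F → EuclideanSpace ℝ (Fin n)) w ≤ B)
    (μ : Measure (EuclideanSpace ℝ (Fin n))) [IsProbabilityMeasure μ] (hμ : ∀ᵐ x ∂μ, x ∈ K) :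
    rieszDoubleIntegral p μ ≤ B := by
  obtain ⟨x₀, hx₀⟩ := hμ.exists
  -- Simple functions into `K` approximating the identity push `μ` forward to finitely supported
  -- measures on `K`.
  obtain ⟨φ, hφK, hφlim⟩ : ∃ φ : ℕ → SimpleFunc (EuclideanSpace ℝ (Fin n))
      (EuclideanSpace ℝ (Fin n)), (∀ k x, φ k x ∈ K) ∧
      ∀ x ∈ K, Tendsto (fun k => φ k x) atTop (𝓝 x) :=
    ⟨SimpleFunc.approxOn id measurable_id K x₀ hx₀, fun k x => SimpleFunc.approxOn_mem _ _ _ _,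
      fun x hx => SimpleFunc.tendsto_approxOn measurable_id hx₀ (subset_closure hx)⟩
  refine le_of_tendsto (tendsto_rieszDoubleIntegral_map hp hK μ hμ (fun k => (φ k).measurable)
    hφK hφlim) (Eventually.of_forall fun k => ?_)
  have hm : AEMeasurable (φ k) μ := (φ k).measurable.aemeasurable
  have := Measure.isProbabilityMeasure_map hm
  obtain ⟨w, hw, h⟩ := exists_rieszDoubleIntegral_eq_rieszForm p (φ k).range (μ.map (φ k))
    ((ae_map_iff hm (Finset.measurableSet _)).2
      (Eventually.of_forall fun x => (φ k).mem_range_self x))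
  rw [h]
  refine hB (φ k).range (fun x hx => ?_) w hw
  obtain ⟨y, rfl⟩ := SimpleFunc.mem_range.1 hx
  exact hφK k y

theorem rieszEnergy_le_of_forall_finset {n : ℕ} {p : ℝ} (hp : p < 0)
    {K : Set (EuclideanSpace ℝ (Fin n))} (hK : IsCompact K) (hne : K.Nonempty) {B : ℝ}
    (hB : ∀ F : Finset (EuclideanSpace ℝ (Fin n)), (∀ x ∈ F, x ∈ K) → ∀ w ∈ stdSimplex ℝ F,
      rieszForm (-p) (Subtype.val : F → EuclideanSpace ℝ (Fin n)) w ≤ B) :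
    rieszEnergy p K ≤ B := by
  obtain ⟨a, ha⟩ := hne
  refine csSup_le ⟨_, rieszForm_mem_rieszEnergyValues (ι := Unit) (w := fun _ => 1)
    hK.measurableSet (fun _ => ha) ⟨fun _ => zero_le_one, by simp⟩⟩ ?_
  rintro E ⟨μ, hμ, hμK, rfl⟩
  exact rieszDoubleIntegral_le_of_forall_finset hp hK hB μ hμK

/-! ### Energy inequalities and capacity ratios -/

/-- The energy of `N + 1` points at equal distances. -/
theorem rieszEnergy_of_pairwise_dist_eq {n : ℕ} {p : ℝ} (hp : p < 0)
    (T : Finset (EuclideanSpace ℝ (Fin n))) {N : ℕ} (hN : T.card = N + 1) {d : ℝ} (hd : 0 ≤ d)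
    (hT : ∀ x ∈ T, ∀ y ∈ T, x ≠ y → dist x y = d) :
    rieszEnergy p (T : Set (EuclideanSpace ℝ (Fin n))) = (N / (N + 1) : ℝ) * d ^ (-p) := by
  have hK : IsCompact (T : Set (EuclideanSpace ℝ (Fin n))) := T.finite_toSet.isCompact
  have hp' : 0 < -p := by linarith
  refine le_antisymm (rieszEnergy_le_of_forall_finset hp hK
    (Finset.card_pos.1 (by omega)) fun F hF w hw => ?_) ?_
  · rw [rieszForm_eq_of_pairwise_dist_eq hp' (fun i j hij =>
      hT _ (hF _ i.2) _ (hF _ j.2) (Subtype.val_injective.ne hij)) hw]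
    refine mul_le_mul_of_nonneg_right (one_sub_sum_sq_le hw ?_) (Real.rpow_nonneg hd _)
    calc _ ≤ Fintype.card F := Fintype.card_subtype_le _
      _ = F.card := Fintype.card_coe F
      _ ≤ T.card := Finset.card_le_card hF
      _ = N + 1 := hN
  · have hw : (fun _ : T => ((N : ℝ) + 1)⁻¹) ∈ stdSimplex ℝ T := by
      refine ⟨fun _ => by positivity, ?_⟩
      simp only [Finset.sum_const, Finset.card_univ, Fintype.card_coe, hN, nsmul_eq_mul]
      push_cast
      field_simp
    have h := rieszForm_le_rieszEnergy hp hK (x := (Subtype.val : T → _)) (fun i => i.2) hw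
    rw [rieszForm_eq_of_pairwise_dist_eq hp' (fun i j hij =>
      hT _ i.2 _ j.2 (Subtype.val_injective.ne hij)) hw] at h
    refine le_of_eq_of_le ?_ h
    simp only [Finset.sum_const, Finset.card_univ, Fintype.card_coe, hN, nsmul_eq_mul]
    push_cast
    field_simp
    ring

theorem rieszEnergy_nonneg {n : ℕ} {p : ℝ} (hp : p < 0) {K : Set (EuclideanSpace ℝ (Fin n))}
    (hK : IsCompact K) (hK' : K.Nonempty) : 0 ≤ rieszEnergy p K := by
  obtain ⟨a, ha⟩ := hK'
  have hw : (fun _ : Unit => (1 : ℝ)) ∈ stdSimplex ℝ Unit := ⟨fun _ => zero_le_one, by simp⟩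
  exact (rieszForm_nonneg hw.1).trans
    (rieszForm_le_rieszEnergy hp hK (x := fun _ : Unit => a) (fun _ => ha) hw)

/-- An inequality between normalized energies, as a bound for the ratio of capacities. -/
theorem rieszCapacity_div_le {n : ℕ} {p q κ : ℝ} (hp : p < 0) (hq : q < 0) (hκ : 0 < κ)
    {K : Set (EuclideanSpace ℝ (Fin n))} (hK : IsCompact K) (hK' : K.Nontrivial)
    (h : κ * rieszEnergy q K ≤ (κ * rieszEnergy p K) ^ (q / p)) :
    rieszCapacity q K / rieszCapacity p K ≤ κ ^ (1 / q - 1 / p) := by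
  have h0 : ∀ r < 0, 0 ≤ rieszEnergy r K := fun r hr => rieszEnergy_nonneg hr hK hK'.nonempty
  rw [div_le_iff₀ (rieszCapacity_pos hp hK hK')]
  have hpow := Real.rpow_le_rpow (mul_nonneg hκ.le (h0 q hq)) h
    (z := -1 / q) (div_nonneg_of_nonpos (by norm_num) hq.le)
  rw [← Real.rpow_mul (mul_nonneg hκ.le (h0 p hp)),
    show q / p * (-1 / q) = -1 / p by have := hp.ne; have := hq.ne; field_simp,
    Real.mul_rpow hκ.le (h0 q hq), Real.mul_rpow hκ.le (h0 p hp)] at hpow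
  rw [show 1 / q - 1 / p = -(-1 / q) + -1 / p by ring, Real.rpow_add hκ, Real.rpow_neg hκ.le,
    mul_assoc, ← div_eq_inv_mul, le_div_iff₀ (Real.rpow_pos_of_pos hκ _), mul_comm]
  exact hpow

/-- The factor `(n + 1) / n` absorbs the Hölder constant, giving the form required by
`rieszCapacity_div_le`. -/
theorem rieszEnergy_le_of_le_neg_two {n : ℕ} (hn : 0 < n) {p q : ℝ} (hpq : p < q) (hq : q ≤ -2)
    {K : Set (EuclideanSpace ℝ (Fin n))} (hK : IsCompact K) (hK' : K.Nonempty) :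
    ((n + 1) / n : ℝ) * rieszEnergy q K ≤ (((n + 1) / n : ℝ) * rieszEnergy p K) ^ (q / p) := by
  have hn' : (0 : ℝ) < n := by exact_mod_cast hn
  have hκ : (0 : ℝ) < (n + 1) / n := by positivity
  have hp0 : p < 0 := by linarith
  have h : rieszEnergy q K ≤ (n / (n + 1) : ℝ) ^ (1 - q / p) * rieszEnergy p K ^ (q / p) := by
    refine rieszEnergy_le_of_forall_finset (by linarith) hK hK' fun F hF w hw => ?_
    rw [← neg_div_neg_eq q p]
    exact rieszForm_le_of_two_le (by linarith) (by linarith) Subtype.val_injective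
      (fun v hv => rieszForm_le_rieszEnergy hp0 hK (fun i => hF _ i.2) hv) hw
  refine (mul_le_mul_of_nonneg_left h hκ.le).trans_eq ?_
  rw [Real.mul_rpow hκ.le (rieszEnergy_nonneg hp0 hK hK'), ← mul_assoc]
  congr 1
  rw [← inv_div ((n : ℝ) + 1) n, Real.inv_rpow hκ.le, ← Real.rpow_neg hκ.le, neg_sub,
    Real.rpow_sub hκ, Real.rpow_one, mul_div_cancel₀ _ hκ.ne']

theorem rieszEnergy_le_of_lt {n : ℕ} {p q : ℝ} (hqp : q < p) (hp : p < 0)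
    {K : Set (EuclideanSpace ℝ (Fin n))} (hK : IsCompact K) (hK' : K.Nonempty) :
    2 * rieszEnergy q K ≤ (2 * rieszEnergy p K) ^ (q / p) := by
  set P := rieszEnergy p K with hP
  have hP0 : 0 ≤ 2 * P := mul_nonneg zero_le_two (rieszEnergy_nonneg hp hK hK')
  have hp' : 0 < -p := by linarith
  have hdist : ∀ x ∈ K, ∀ y ∈ K, dist x y ^ (p - q) ≤ (2 * P) ^ (q / p - 1) := by
    intro x hx y hy
    have hw : (fun _ : Bool => (1 / 2 : ℝ)) ∈ stdSimplex ℝ Bool :=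
      ⟨fun _ => by norm_num, by simp⟩
    -- Testing the energy with mass `1/2` at `x` and at `y`.
    have h : dist x y ^ (-p) ≤ 2 * P := by
      have h := rieszForm_le_rieszEnergy hp hK (x := fun b : Bool => if b then x else y)
        (fun b => by cases b <;> simp [hx, hy]) hw
      simp only [rieszForm, Fintype.sum_bool, if_true, Bool.false_eq_true, if_false, dist_self,
        Real.zero_rpow hp'.ne', dist_comm y x] at h
      linarith
    have h2 := Real.rpow_le_rpow (Real.rpow_nonneg dist_nonneg _) h (z := q / p - 1)
      (by rw [sub_nonneg, le_div_iff_of_neg hp]; linarith)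
    rwa [← Real.rpow_mul dist_nonneg, show -p * (q / p - 1) = p - q by
      have := hp.ne
      field_simp
      ring] at h2
  have h : rieszEnergy q K ≤ (2 * P) ^ (q / p - 1) * P := by
    refine rieszEnergy_le_of_forall_finset (by linarith) hK hK' fun F hF w hw => ?_
    refine le_trans ?_ (mul_le_mul_of_nonneg_left
      (rieszForm_le_rieszEnergy hp hK (fun i : F => hF _ i.2) hw) (Real.rpow_nonneg hP0 _))
    simp only [rieszForm, Finset.mul_sum]
    refine Finset.sum_le_sum fun i _ => Finset.sum_le_sum fun j _ => ?_
    rw [mul_left_comm]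
    refine mul_le_mul_of_nonneg_left ?_ (mul_nonneg (hw.1 i) (hw.1 j))
    rw [show -q = (p - q) + -p by ring,
      Real.rpow_add_of_nonneg dist_nonneg (by linarith) hp'.le]
    exact mul_le_mul_of_nonneg_right (hdist _ (hF _ i.2) _ (hF _ j.2))
      (Real.rpow_nonneg dist_nonneg _)
  have hqp0 : q / p ≠ 0 := (div_pos_of_neg_of_neg (by linarith) hp).ne'
  calc 2 * rieszEnergy q K ≤ (2 * P) ^ (q / p - 1) * (2 * P) := by linarith
    _ = (2 * P) ^ (q / p) := by
      nth_rewrite 2 [← Real.rpow_one (2 * P)]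
      rw [← Real.rpow_add' hP0 (by simpa using hqp0), sub_add_cancel]

/-- The capacity is `((N + 1) / N) ^ (1 / r) * d`, so `d` cancels. Triangles are `N = 2`, pairs `N =
1`. -/
theorem rieszCapacity_div_eq {n : ℕ} {p q : ℝ} (hp : p < 0) (hq : q < 0)
    (T : Finset (EuclideanSpace ℝ (Fin n))) {N : ℕ} (hN : T.card = N + 1) (hN0 : 0 < N) {d : ℝ}
    (hd : 0 < d) (hT : ∀ x ∈ T, ∀ y ∈ T, x ≠ y → dist x y = d) :
    rieszCapacity q (T : Set (EuclideanSpace ℝ (Fin n))) / rieszCapacity p (T : Set (EuclideanSpace ℝ (Fin n))) =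
      ((N + 1) / N : ℝ) ^ (1 / q - 1 / p) := by
  have hN' : (0 : ℝ) < N := by exact_mod_cast hN0
  have hκ : (0 : ℝ) < (N + 1) / N := by positivity
  have key : ∀ r < 0, rieszCapacity r (T : Set (EuclideanSpace ℝ (Fin n))) =
      ((N + 1) / N : ℝ) ^ (1 / r) * d := by
    intro r hr
    rw [rieszCapacity, rieszEnergy_of_pairwise_dist_eq hr T hN hd.le hT,
      Real.mul_rpow (by positivity) (Real.rpow_nonneg hd.le _), ← Real.rpow_mul hd.le,
      show -r * (-1 / r) = 1 by have := hr.ne; field_simp, Real.rpow_one,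
      ← inv_div ((N : ℝ) + 1) N,
      Real.inv_rpow hκ.le, ← Real.rpow_neg hκ.le]
    ring_nf
  rw [key q hq, key p hp, mul_div_mul_right _ _ hd.ne', Real.rpow_sub hκ]

theorem rieszCapacity_div_of_isRegularThreePointSet {n : ℕ} {p q : ℝ} (hp : p < 0) (hq : q < 0)
    {T : Set (EuclideanSpace ℝ (Fin n))} (hT : IsRegularThreePointSet T) :
    rieszCapacity q T / rieszCapacity p T = (2 / 3 : ℝ) ^ (1 / p - 1 / q) := by
  classical
  obtain ⟨a, b, c, d, hd, hab, hbc, hca, rfl⟩ := hT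
  have h := rieszCapacity_div_eq hp hq {a, b, c} (N := 2) (d := d)
    (Finset.card_eq_three.2 ⟨a, b, c, dist_pos.1 (hab ▸ hd), (dist_pos.1 (hca ▸ hd)).symm,
      dist_pos.1 (hbc ▸ hd), rfl⟩) two_pos hd (by
      simp only [Finset.mem_insert, Finset.mem_singleton]
      rintro x (rfl | rfl | rfl) y (rfl | rfl | rfl) hxy <;>
        first | exact absurd rfl hxy | assumption | (rw [dist_comm]; assumption))
  simp only [Finset.coe_insert, Finset.coe_singleton] at h
  rw [h, ← neg_sub (1 / q), Real.rpow_neg (by norm_num), ← Real.inv_rpow (by norm_num)]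
  norm_num

theorem rieszCapacity_div_of_ncard_eq_two {n : ℕ} {p q : ℝ} (hp : p < 0) (hq : q < 0)
    {T : Set (EuclideanSpace ℝ (Fin n))} (hT : T.ncard = 2) :
    rieszCapacity q T / rieszCapacity p T = (2 : ℝ) ^ (1 / q - 1 / p) := by
  classical
  obtain ⟨a, b, hab, rfl⟩ := Set.ncard_eq_two.1 hT
  have h := rieszCapacity_div_eq hp hq {a, b} (N := 1) (d := dist a b)
    (Finset.card_pair hab) one_pos (dist_pos.2 hab) (by
      simp only [Finset.mem_insert, Finset.mem_singleton]
      rintro x (rfl | rfl) y (rfl | rfl) hxy <;>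
        first | exact absurd rfl hxy | rfl | exact dist_comm _ _)
  simp only [Finset.coe_insert, Finset.coe_singleton] at h
  rw [h]
  norm_num

theorem exists_isRegularThreePointSet :
    ∃ T : Set (EuclideanSpace ℝ (Fin 2)), IsRegularThreePointSet T := by
  refine ⟨_, !₂[0, 0], !₂[1, 0], !₂[1 / 2, √3 / 2], 1, one_pos, ?_, ?_, ?_, rfl⟩ <;>
    rw [EuclideanSpace.dist_eq, Real.sqrt_eq_one] <;>
    simp [Real.dist_eq, div_pow] <;> norm_num

theorem mainTheorem1 :
    (∀ p q : ℝ, p < q → q ≤ -2 →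
      IsGreatest (rieszCapacityRatios 2 p q) ((2 / 3 : ℝ) ^ (1 / p - 1 / q)) ∧
      ∀ T : Set (EuclideanSpace ℝ (Fin 2)), IsRegularThreePointSet T →
        rieszCapacity q T / rieszCapacity p T = (2 / 3 : ℝ) ^ (1 / p - 1 / q)) ∧
    (∀ p q : ℝ, q < p → p < 0 → q ≤ -2 →
      IsGreatest (rieszCapacityRatios 2 p q) ((2 : ℝ) ^ (1 / q - 1 / p)) ∧
      ∀ T : Set (EuclideanSpace ℝ (Fin 2)), T.ncard = 2 →
        rieszCapacity q T / rieszCapacity p T = (2 : ℝ) ^ (1 / q - 1 / p)) := by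
  constructor
  · intro p q hpq hq
    have hp0 : p < 0 := by linarith
    have hq0 : q < 0 := by linarith
    refine ⟨⟨?_, ?_⟩, fun T hT => rieszCapacity_div_of_isRegularThreePointSet hp0 hq0 hT⟩
    · obtain ⟨T, hT⟩ := exists_isRegularThreePointSet
      refine ⟨T, ?_, ?_, (rieszCapacity_div_of_isRegularThreePointSet hp0 hq0 hT).symm⟩ <;>
        obtain ⟨a, b, c, d, hd, hab, -, -, rfl⟩ := hT
      · exact (Set.toFinite _).isCompact
      · exact ⟨a, by simp, b, by simp, dist_pos.1 (hab ▸ hd)⟩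
    · rintro r ⟨K, hK, hK', rfl⟩
      have h := rieszCapacity_div_le hp0 hq0 (by norm_num) hK hK'
        (rieszEnergy_le_of_le_neg_two two_pos hpq hq hK hK'.nonempty)
      refine h.trans_eq ?_
      rw [← neg_sub (1 / p), Real.rpow_neg (by norm_num), ← Real.inv_rpow (by norm_num)]
      norm_num
  · intro p q hqp hp hq
    have hq0 : q < 0 := by linarith
    refine ⟨⟨?_, ?_⟩, fun T hT => rieszCapacity_div_of_ncard_eq_two hp hq0 hT⟩
    · obtain ⟨a, b, hab⟩ := exists_pair_ne (EuclideanSpace ℝ (Fin 2))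
      exact ⟨{a, b}, (Set.toFinite _).isCompact, ⟨a, by simp, b, by simp, hab⟩,
        (rieszCapacity_div_of_ncard_eq_two hp hq0 (Set.ncard_pair hab)).symm⟩
    · rintro r ⟨K, hK, hK', rfl⟩
      exact rieszCapacity_div_le hp hq0 two_pos hK hK'
        (rieszEnergy_le_of_lt hqp hp hK hK'.nonempty)
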